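/- Let $m$ be normalized Lebesgue measure on the unit circle $\mathbb T$, $L^2=L^2(\mathbb T,m)$, and let $H^2\subset L^2$ be the Hardy space of functions whose Fourier coefficients of negative index vanish. Let $u$ be a non-constant inner function, $\mathcal K_u=H^2\ominus uH^2$, and let $P_u$ be the orthogonal projection of $L^2$ onto $\mathcal K_u$. A function $\Phi\in L^2$ is a symbol of a bounded operator $A$ on $\mathcal K_u$ if $Af=P_u(\Phi f)$ for every bounded function $f\in\mathcal K_u$; let $\mathcal T_u$ be the set of bounded operators on $\mathcal K_u$ that have a symbol (the bounded truncated Toeplitz operators, TTOs). Let $S_uf=P_u(zf)$ be the compressed shift and $Cf=u\,\overline{zf}$ the conjugation on $\mathcal K_u$. An operator $A\in\mathcal T_u$ is of type $\alpha\in\mathbb C$ if it has a symbol of the form $\varphi+\alpha\,\overline{S_uC\varphi}+c$ with $\varphi\in\mathcal K_u$ and $c\in\mathbb C$, and it is of type $\infty$ if it has an antiholomorphic symbol, i.e. a symbol $\overline\psi$ with $\psi\in H^2$. Proposition. Let $A\in\mathcal T_u$. If $A$ is of type $\alpha$ and of type $\beta$, where $\alpha,\beta\in\mathbb C\cup\{\infty\}$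 and $\alpha\neq\beta$, then $A=cI$ for some $c\in\mathbb C$. Consequently, every $A\in\mathcal T_u$ is of no type, of exactly one type, or of every type $\alpha\in\mathbb C\cup\{\infty\}$. -/

import Mathlib

open MeasureTheory AddCircle
open scoped ENNReal

noncomputable section

namespace TTO

/-- The space `L^p` of the unit circle with normalized Lebesgue measure `m`. The circle is
parametrized as `ℝ ⧸ ℤ` by `t ↦ exp (2 π i t)`, so that the coordinate function `z` is
`fourier 1`. -/
abbrev LpT (p : ℝ≥0∞) : Type := Lp ℂ p (haarAddCircle : Measure UnitAddCircle)

/-- The coordinate function `z` on the unit circle. -/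
def coordZ : LpT ∞ := fourierLp ∞ 1

/-- The product `Φ f ∈ L²` of `Φ ∈ L^∞` and `f ∈ L²`, as a linear map in `f`. -/
def mulL (Φ : LpT ∞) : LpT 2 →ₗ[ℂ] LpT 2 where
  toFun f := (Φ • f : LpT 2)
  map_add' f g := Lp.add_smul Φ f g
  map_smul' c f := (Lp.smul_comm c Φ f).symm

/-- The Hardy space `H²`: the functions in `L²` whose Fourier coefficients of negative index
all vanish. -/
def hardySpace : Submodule ℂ (LpT 2) where
  carrier := {f | ∀ n : ℤ, n < 0 → fourierCoeff f n = 0}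
  zero_mem' := by
    intro n _
    rw [← fourierBasis_repr]
    simp
  add_mem' := by
    intro f g hf hg n hn
    have h1 := hf n hn
    have h2 := hg n hn
    rw [← fourierBasis_repr] at h1 h2 ⊢
    simp [h1, h2]
  smul_mem' := by
    intro c f hf n hn
    have h1 := hf n hn
    rw [← fourierBasis_repr] at h1 ⊢
    simp [h1]

/-- An inner function, given by its boundary function: a bounded function on the circle that is
unimodular almost everywhere and whose Fourier coefficients of negative index all vanish. -/
structure IsInner (u : LpT ∞) : Prop where
  norm_eq_one : ∀ᵐ x ∂(haarAddCircle : Measure UnitAddCircle), ‖u x‖ = 1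
  fourierCoeff_eq_zero : ∀ n : ℤ, n < 0 → fourierCoeff u n = 0

/-- The model space `K_u = H² ⊖ u H²`. -/
def modelSpace (u : LpT ∞) : Submodule ℂ (LpT 2) :=
  hardySpace ⊓ (hardySpace.map (mulL u))ᗮ

theorem isClosed_hardySpace : IsClosed (hardySpace : Set (LpT 2)) := by
  have h : (hardySpace : Set (LpT 2)) =
      ⋂ n : ℤ, ⋂ _ : n < 0, {f : LpT 2 | inner ℂ (fourierBasis n) f = 0} := by
    ext f
    simp only [Set.mem_iInter, Set.mem_ofPred_eq, ← HilbertBasis.repr_apply_apply,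
      fourierBasis_repr]
    rfl
  rw [h]
  exact isClosed_iInter fun n => isClosed_iInter fun _ =>
    isClosed_eq (continuous_const.inner continuous_id) continuous_const

instance (u : LpT ∞) : CompleteSpace (modelSpace u) := by
  have h : IsClosed (modelSpace u : Set (LpT 2)) := by
    rw [modelSpace, Submodule.coe_inf]
    exact isClosed_hardySpace.inter (Submodule.isClosed_orthogonal _)
  exact h.completeSpace_coe

/-- The orthogonal projection `P_u` of `L²` onto `K_u`. -/
def projU (u : LpT ∞) : LpT 2 →L[ℂ] modelSpace u := (modelSpace u).orthogonalProjectionOnto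

/-- `P_u (Φ f)` for a symbol `Φ ∈ L²` and a bounded function `f ∈ K_u`. -/
def truncatedToeplitz (u : LpT ∞) (Φ : LpT 2) (f : modelSpace u)
    (hf : MemLp (f : LpT 2) ∞ (haarAddCircle : Measure UnitAddCircle)) : modelSpace u :=
  projU u (Φ • (hf.toLp (f : LpT 2) : LpT ∞) : LpT 2)

/-- The bounded operator `A` on `K_u` has the symbol `Φ ∈ L²`: it extends the truncated Toeplitz
operator `A_Φ`, whose domain consists of the bounded functions in `K_u`. -/
def HasSymbol (u : LpT ∞) (A : modelSpace u →L[ℂ] modelSpace u) (Φ : LpT 2) : Prop :=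
  ∀ (f : modelSpace u) (hf : MemLp (f : LpT 2) ∞ (haarAddCircle : Measure UnitAddCircle)),
    A f = truncatedToeplitz u Φ f hf

/-- The set `𝒯_u` of the bounded truncated Toeplitz operators on `K_u`. -/
def boundedTTO (u : LpT ∞) : Set (modelSpace u →L[ℂ] modelSpace u) :=
  {A | ∃ Φ : LpT 2, HasSymbol u A Φ}

/-- The conjugation `C f = u · conj (z f)` on `L²`. -/
def conjC (u : LpT ∞) (f : LpT 2) : LpT 2 := mulL u (star (mulL coordZ f))

/-- The function `S_u C φ`, where `S_u` is the compressed shift `f ↦ P_u (z f)`. -/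
def shiftConj (u : LpT ∞) (φ : modelSpace u) : modelSpace u :=
  projU u (mulL coordZ (conjC u φ))

/-- `A` is of type `α`, for `α` in the Riemann sphere `ℂ ∪ {∞}`. For `α ∈ ℂ` this means that `A`
has a symbol `φ + α · conj (S_u C φ) + c` with `φ ∈ K_u` and `c ∈ ℂ`; for `α = ∞` it means that
`A` has an antiholomorphic symbol, that is, one whose conjugate is in `H²`. -/
def IsOfType (u : LpT ∞) (A : modelSpace u →L[ℂ] modelSpace u) : OnePoint ℂ → Prop
  | .infty => ∃ ψ ∈ hardySpace, HasSymbol u A (star ψ)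
  | .some α => ∃ (φ : modelSpace u) (c : ℂ),
      HasSymbol u A ((φ : LpT 2) + α • star (shiftConj u φ : LpT 2) + Lp.const 2 haarAddCircle c)

end TTO

end

open MeasureTheory AddCircle
open scoped ENNReal

noncomputable section

namespace TTO

/-! ### Multiplication and conjugation on `L²` -/

theorem coeFn_mulL (a : LpT ∞) (f : LpT 2) :
    mulL a f =ᵐ[haarAddCircle] fun x => a x * f x :=
  Lp.coeFn_lpSMul a f

theorem coeFn_star_lp {p : ℝ≥0∞} (f : LpT p) :
    (star f : LpT p) =ᵐ[haarAddCircle] fun x => star (f x) :=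
  Lp.coeFn_star f

theorem inner_mulL_left (a : LpT ∞) (f g : LpT 2) :
    inner ℂ (mulL a f) g = inner ℂ f (mulL (star a) g) := by
  rw [L2.inner_def, L2.inner_def]
  apply integral_congr_ae
  filter_upwards [coeFn_mulL a f, coeFn_mulL (star a) g, coeFn_star_lp a] with x h1 h2 h3
  rw [h1, h2, h3]
  simp only [RCLike.inner_apply, map_mul, RCLike.star_def]
  ring

theorem inner_star_star (f g : LpT 2) : inner ℂ (star f) (star g) = inner ℂ g f := by
  rw [L2.inner_def, L2.inner_def]
  apply integral_congr_ae
  filter_upwards [coeFn_star_lp f, coeFn_star_lp g] with x h1 h2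
  rw [h1, h2]
  simp only [RCLike.inner_apply, RCLike.star_def, RCLike.conj_conj]
  ring

theorem inner_star_left (f g : LpT 2) : inner ℂ (star f) g = inner ℂ (star g) f := by
  conv_lhs => rw [← star_star g]
  exact inner_star_star f (star g)

theorem mulL_comm (a b : LpT ∞) (f : LpT 2) : mulL a (mulL b f) = mulL b (mulL a f) := by
  apply Lp.ext
  filter_upwards [coeFn_mulL a (mulL b f), coeFn_mulL b f, coeFn_mulL b (mulL a f),
    coeFn_mulL a f] with x h1 h2 h3 h4
  rw [h1, h2, h3, h4]
  ring

theorem star_mulL (a : LpT ∞) (f : LpT 2) : star (mulL a f) = mulL (star a) (star f) := by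
  apply Lp.ext
  filter_upwards [coeFn_mulL a f, coeFn_mulL (star a) (star f), coeFn_star_lp (mulL a f),
    coeFn_star_lp a, coeFn_star_lp f] with x h1 h2 h3 h4 h5
  rw [h3, h1, h2, h4, h5]
  exact star_mul' _ _

theorem star_add_lp (f g : LpT 2) : star (f + g) = star f + star g := by
  apply Lp.ext
  filter_upwards [coeFn_star_lp (f + g), Lp.coeFn_add f g, Lp.coeFn_add (star f) (star g),
    coeFn_star_lp f, coeFn_star_lp g] with x h1 h2 h3 h4 h5
  rw [h1, h2, h3, Pi.add_apply, Pi.add_apply, h4, h5]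
  exact star_add _ _

theorem star_smul_lp (c : ℂ) (f : LpT 2) : star (c • f) = star c • star f := by
  apply Lp.ext
  filter_upwards [coeFn_star_lp (c • f), Lp.coeFn_smul c f, Lp.coeFn_smul (star c) (star f),
    coeFn_star_lp f] with x h1 h2 h3 h4
  rw [h1, h2, h3, Pi.smul_apply, Pi.smul_apply, h4]
  exact star_smul _ _

theorem star_sub_lp (f g : LpT 2) : star (f - g) = star f - star g := by
  rw [sub_eq_add_neg, ← neg_one_smul ℂ g, star_add_lp, star_smul_lp, star_neg, star_one,
    neg_one_smul, ← sub_eq_add_neg]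

/-- The exponential `z ^ n` in `L²`. -/
abbrev expo (n : ℤ) : LpT 2 := fourierLp 2 n

theorem coeFn_expo_zero : expo 0 =ᵐ[haarAddCircle] fun _ => (1 : ℂ) := by
  filter_upwards [coeFn_fourierLp (T := 1) 2 0] with x h
  rw [h, fourier_zero]

theorem const_eq_smul_expo (c : ℂ) : Lp.const 2 haarAddCircle c = c • expo 0 := by
  apply Lp.ext
  filter_upwards [Lp.coeFn_const (μ := (haarAddCircle : Measure UnitAddCircle)) (p := 2) (c := c),
    Lp.coeFn_smul c (expo 0), coeFn_expo_zero] with x h1 h2 h3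
  rw [h1, h2, Pi.smul_apply, h3]
  simp

theorem star_expo (n : ℤ) : star (expo n) = expo (-n) := by
  apply Lp.ext
  filter_upwards [coeFn_star_lp (expo n), coeFn_fourierLp (T := 1) 2 n,
    coeFn_fourierLp (T := 1) 2 (-n)] with x h1 h2 h3
  rw [h1, h2, h3, fourier_neg]
  rfl

theorem star_expo_zero : star (expo 0) = expo 0 := by
  rw [star_expo, neg_zero]

theorem mulL_coordZ_expo (n : ℤ) : mulL coordZ (expo n) = expo (n + 1) := by
  apply Lp.ext
  filter_upwards [coeFn_mulL coordZ (expo n), coeFn_fourierLp (T := 1) 2 n,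
    coeFn_fourierLp (T := 1) ∞ 1, coeFn_fourierLp (T := 1) 2 (n + 1)] with x h1 h2 h3 h4
  rw [h1, h2, h4, coordZ, h3, add_comm n 1, fourier_add]

theorem norm_coordZ : ∀ᵐ x ∂(haarAddCircle : Measure UnitAddCircle), ‖coordZ x‖ = 1 := by
  filter_upwards [coeFn_fourierLp (T := 1) ∞ 1] with x h
  rw [coordZ, h, fourier_apply, Circle.norm_coe]

theorem mulL_mulL_star {a : LpT ∞}
    (ha : ∀ᵐ x ∂(haarAddCircle : Measure UnitAddCircle), ‖a x‖ = 1) (f : LpT 2) :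
    mulL a (mulL (star a) f) = f := by
  apply Lp.ext
  filter_upwards [coeFn_mulL a (mulL (star a) f), coeFn_mulL (star a) f, coeFn_star_lp a, ha]
    with x h1 h2 h3 h4
  rw [h1, h2, h3, ← mul_assoc, RCLike.star_def, RCLike.mul_conj, h4]
  simp

theorem mulL_star_mulL {a : LpT ∞}
    (ha : ∀ᵐ x ∂(haarAddCircle : Measure UnitAddCircle), ‖a x‖ = 1) (f : LpT 2) :
    mulL (star a) (mulL a f) = f := by
  rw [mulL_comm, mulL_mulL_star ha]

theorem inner_mulL_mulL {a : LpT ∞}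
    (ha : ∀ᵐ x ∂(haarAddCircle : Measure UnitAddCircle), ‖a x‖ = 1) (f g : LpT 2) :
    inner ℂ (mulL a f) (mulL a g) = inner ℂ f g := by
  rw [inner_mulL_left, mulL_star_mulL ha]

theorem mulL_coordZ_conjC (u : LpT ∞) (f : LpT 2) :
    mulL coordZ (conjC u f) = mulL u (star f) := by
  rw [conjC, mulL_comm, star_mulL, mulL_mulL_star norm_coordZ]

/-! ### Hardy space -/

theorem inner_expo (n : ℤ) (f : LpT 2) : inner ℂ (expo n) f = fourierCoeff f n := by
  rw [← fourierBasis_repr, HilbertBasis.repr_apply_apply, coe_fourierBasis]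

theorem mem_hardySpace {f : LpT 2} :
    f ∈ hardySpace ↔ ∀ n : ℤ, n < 0 → inner ℂ (expo n) f = 0 := by
  simp only [inner_expo]
  rfl

theorem inner_eq_zero_of_mem_hardySpace {f g : LpT 2} (hf : f ∈ hardySpace)
    (hg : ∀ n : ℤ, 0 ≤ n → inner ℂ (expo n) g = 0) : inner ℂ f g = 0 := by
  have h := (fourierBasis (T := 1)).hasSum_inner_mul_inner f g
  refine h.unique ?_
  convert hasSum_zero with n
  rw [coe_fourierBasis]
  rcases lt_or_ge n 0 with hn | hn
  · rw [← inner_conj_symm, mem_hardySpace.1 hf n hn, map_zero, zero_mul]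
  · rw [hg n hn, mul_zero]

theorem inner_expo_expo (m n : ℤ) : inner ℂ (expo m) (expo n) = if m = n then 1 else 0 :=
  orthonormal_iff_ite.1 (orthonormal_fourier (T := 1)) m n

theorem expo_mem_hardySpace {n : ℤ} (hn : 0 ≤ n) : expo n ∈ hardySpace := by
  rw [mem_hardySpace]
  intro m hm
  rw [inner_expo_expo, if_neg (by omega)]

theorem inner_expo_mulL_coordZ (n : ℤ) (f : LpT 2) :
    inner ℂ (expo n) (mulL coordZ f) = inner ℂ (expo (n - 1)) f := by
  rw [← inner_mulL_mulL norm_coordZ (expo (n - 1)), mulL_coordZ_expo, sub_add_cancel]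

theorem mulL_coordZ_mem_hardySpace {f : LpT 2} (hf : f ∈ hardySpace) :
    mulL coordZ f ∈ hardySpace := by
  rw [mem_hardySpace] at hf ⊢
  intro n hn
  rw [inner_expo_mulL_coordZ]
  exact hf _ (by omega)

theorem inner_expo_zero_mulL_coordZ {f : LpT 2} (hf : f ∈ hardySpace) :
    inner ℂ (expo 0) (mulL coordZ f) = 0 := by
  rw [inner_expo_mulL_coordZ]
  exact mem_hardySpace.1 hf _ (by omega)

theorem inner_mulL_expo_expo {u : LpT ∞} (hu : IsInner u) {m n : ℤ} (h : n < m) :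
    inner ℂ (mulL u (expo m)) (expo n) = 0 := by
  rw [← inner_conj_symm, L2.inner_def, map_eq_zero,
    ← hu.fourierCoeff_eq_zero (n - m) (by omega), fourierCoeff]
  apply integral_congr_ae
  filter_upwards [coeFn_mulL u (expo m), coeFn_fourierLp (T := 1) 2 n,
    coeFn_fourierLp (T := 1) 2 m] with x h1 h2 h3
  rw [h1, h2, h3, neg_sub, sub_eq_add_neg, fourier_add, fourier_neg]
  simp only [RCLike.inner_apply, smul_eq_mul]
  ring

theorem mulL_mem_hardySpace {u : LpT ∞} (hu : IsInner u) {f : LpT 2} (hf : f ∈ hardySpace) :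
    mulL u f ∈ hardySpace := by
  rw [mem_hardySpace]
  intro n hn
  rw [← inner_conj_symm, inner_mulL_left, inner_eq_zero_of_mem_hardySpace hf, map_zero]
  intro m hm
  rw [← inner_mulL_left]
  exact inner_mulL_expo_expo hu (by omega)

/-! ### The model space -/

theorem mem_modelSpace {u : LpT ∞} {f : LpT 2} :
    f ∈ modelSpace u ↔ f ∈ hardySpace ∧ ∀ h ∈ hardySpace, inner ℂ (mulL u h) f = 0 := by
  rw [modelSpace, Submodule.mem_inf, Submodule.mem_orthogonal]
  refine and_congr_right fun _ => ⟨fun h g hg => h _ (Submodule.mem_map_of_mem hg), ?_⟩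
  rintro h _ ⟨g, hg, rfl⟩
  exact h g hg

theorem inner_projU (u : LpT ∞) (g : modelSpace u) (f : LpT 2) :
    inner ℂ (g : LpT 2) (projU u f : LpT 2) = inner ℂ (g : LpT 2) f :=
  Submodule.inner_orthogonalProjectionOnto_eq_of_mem_left g f

theorem projU_coe (u : LpT ∞) (g : modelSpace u) : projU u (g : LpT 2) = g :=
  Submodule.orthogonalProjectionOnto_mem_subspace_eq_self g

theorem projU_eq_zero {u : LpT ∞} {f : LpT 2}
    (h : ∀ g ∈ modelSpace u, inner ℂ g f = 0) : projU u f = 0 := by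
  refine Subtype.ext (inner_self_eq_zero (𝕜 := ℂ) |>.1 ?_)
  rw [inner_projU]
  exact h _ (projU u f).2

theorem projU_mulL_eq_zero {u : LpT ∞} {h : LpT 2} (hh : h ∈ hardySpace) :
    projU u (mulL u h) = 0 := by
  refine projU_eq_zero fun g hg => ?_
  rw [← inner_conj_symm, (mem_modelSpace.1 hg).2 h hh, map_zero]

theorem projU_mulL_star_eq_zero {u : LpT ∞} {f : LpT 2} (hf : f ∈ modelSpace u) :
    projU u (mulL (star u) f) = 0 := by
  refine projU_eq_zero fun g hg => ?_
  rw [← inner_mulL_left]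
  exact (mem_modelSpace.1 hf).2 g (mem_modelSpace.1 hg).1

/-- The reproducing kernel `k₀ = P_u 1` of the model space at the origin. -/
def kerZero (u : LpT ∞) : modelSpace u := projU u (expo 0)

theorem inner_kerZero (u : LpT ∞) (g : modelSpace u) :
    inner ℂ (g : LpT 2) (kerZero u : LpT 2) = inner ℂ (g : LpT 2) (expo 0) :=
  inner_projU u g _

theorem exists_projU_expo {u : LpT ∞} (hu : IsInner u) (n : ℕ) :
    ∃ c : ℕ → ℂ, (projU u (expo n) : LpT 2) =
      expo n - mulL u (∑ k ∈ Finset.range (n + 1), c k • expo k) := by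
  set c : ℕ → ℂ := fun k => inner ℂ (mulL u (expo k)) (expo n) with hc
  set p : LpT 2 := ∑ k ∈ Finset.range (n + 1), c k • expo k with hp
  have hpH : p ∈ hardySpace := Submodule.sum_mem _ fun k _ =>
    Submodule.smul_mem _ _ (expo_mem_hardySpace (by omega))
  have hmem : expo n - mulL u p ∈ modelSpace u := by
    rw [mem_modelSpace]
    refine ⟨sub_mem (expo_mem_hardySpace (by omega)) (mulL_mem_hardySpace hu hpH), ?_⟩
    intro h hh
    rw [inner_sub_right, inner_mulL_mulL hu.norm_eq_one, inner_mulL_left, ← inner_sub_right]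
    refine inner_eq_zero_of_mem_hardySpace hh fun m hm => ?_
    lift m to ℕ using hm
    rw [inner_sub_right, ← inner_mulL_left, hp, inner_sum]
    simp only [inner_smul_right, inner_expo_expo, Nat.cast_inj, mul_ite, mul_one, mul_zero,
      Finset.sum_ite_eq, Finset.mem_range]
    split_ifs with hmn
    · exact sub_self _
    · rw [sub_zero]
      exact inner_mulL_expo_expo hu (by omega)
  refine ⟨c, ?_⟩
  have h := congrArg (projU u) (sub_add_cancel (expo n) (mulL u p))
  rw [map_add, projU_mulL_eq_zero hpH, add_zero, projU_coe u ⟨_, hmem⟩] at h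
  rw [← h]

theorem exists_kerZero {u : LpT ∞} (hu : IsInner u) :
    ∃ c : ℂ, (kerZero u : LpT 2) = expo 0 - c • mulL u (expo 0) := by
  obtain ⟨c, hc⟩ := exists_projU_expo hu 0
  refine ⟨c 0, ?_⟩
  simpa [kerZero] using hc

theorem kerZero_ne_zero {u : LpT ∞} (hu : IsInner u)
    (hu_nonconst : ∀ c : ℂ, u ≠ Lp.const ∞ haarAddCircle c) : kerZero u ≠ 0 := by
  intro h
  obtain ⟨c, hc⟩ := exists_kerZero hu
  rw [h, Submodule.coe_zero, eq_comm, sub_eq_zero] at hc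
  refine hu_nonconst c⁻¹ ?_
  apply Lp.ext
  have hc' : ∀ᵐ x ∂(haarAddCircle : Measure UnitAddCircle),
      expo 0 x = (c • mulL u (expo 0) : LpT 2) x := by
    rw [← hc]
    exact Filter.Eventually.of_forall fun _ => rfl
  filter_upwards [Lp.coeFn_const (μ := (haarAddCircle : Measure UnitAddCircle)) (p := ∞)
    (c := c⁻¹), hc', Lp.coeFn_smul c (mulL u (expo 0)), coeFn_mulL u (expo 0),
    coeFn_expo_zero] with x h1 h2 h3 h4 h5
  rw [h5, h3, Pi.smul_apply, h4, h5, mul_one, smul_eq_mul] at h2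
  rw [h1, Function.const_apply, eq_comm]
  exact inv_eq_of_mul_eq_one_right h2.symm

/-! ### Bounded functions -/

/-- The essentially bounded functions in `L²`. -/
def boundedL2 : Submodule ℂ (LpT 2) where
  carrier := {f | MemLp f ∞ (haarAddCircle : Measure UnitAddCircle)}
  zero_mem' := (memLp_congr_ae (Lp.coeFn_zero _ _ _)).2 MemLp.zero
  add_mem' hf hg := (memLp_congr_ae (Lp.coeFn_add _ _)).2 (hf.add hg)
  smul_mem' c _ hf := (memLp_congr_ae (Lp.coeFn_smul _ _)).2 (hf.const_smul c)

theorem mem_boundedL2 {f : LpT 2} :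
    f ∈ boundedL2 ↔ MemLp f ∞ (haarAddCircle : Measure UnitAddCircle) :=
  Iff.rfl

theorem expo_mem_boundedL2 (n : ℤ) : expo n ∈ boundedL2 := by
  rw [mem_boundedL2, memLp_congr_ae (coeFn_fourierLp (T := 1) 2 n),
    ← memLp_congr_ae (coeFn_fourierLp (T := 1) ∞ n)]
  exact Lp.memLp _

theorem mulL_mem_boundedL2 (a : LpT ∞) {f : LpT 2} (hf : f ∈ boundedL2) :
    mulL a f ∈ boundedL2 := by
  exact (memLp_congr_ae (Lp.coeFn_lpSMul (r := 2) a f)).2 (MemLp.smul hf (Lp.memLp a))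

theorem projU_expo_mem_boundedL2 {u : LpT ∞} (hu : IsInner u) (n : ℕ) :
    (projU u (expo n) : LpT 2) ∈ boundedL2 := by
  obtain ⟨c, hc⟩ := exists_projU_expo hu n
  rw [hc]
  exact sub_mem (expo_mem_boundedL2 _) (mulL_mem_boundedL2 u (Submodule.sum_mem _ fun k _ =>
    Submodule.smul_mem _ _ (expo_mem_boundedL2 _)))

/-- Bounded functions are dense in the model space. -/
theorem eq_zero_of_forall_bounded {u : LpT ∞} (hu : IsInner u) {g : modelSpace u}
    (h : ∀ f : modelSpace u, (f : LpT 2) ∈ boundedL2 →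
      inner ℂ (f : LpT 2) (g : LpT 2) = 0) : g = 0 := by
  have hz : ∀ n : ℤ, 0 ≤ n → inner ℂ (expo n) (g : LpT 2) = 0 := by
    intro n hn
    lift n to ℕ using hn
    have h0 := h _ (projU_expo_mem_boundedL2 hu n)
    rw [← inner_conj_symm, map_eq_zero, inner_projU] at h0
    rw [← inner_conj_symm, h0, map_zero]
  have : inner ℂ (g : LpT 2) (g : LpT 2) = 0 :=
    inner_eq_zero_of_mem_hardySpace (mem_modelSpace.1 g.2).1 hz
  exact Subtype.ext (inner_self_eq_zero.1 this)


/-! ### Symbols of the zero operator -/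

theorem truncatedToeplitz_eq (u : LpT ∞) (Φ : LpT 2) (f : modelSpace u)
    (hf : MemLp (f : LpT 2) ∞ (haarAddCircle : Measure UnitAddCircle)) :
    truncatedToeplitz u Φ f hf = projU u (mulL (hf.toLp (f : LpT 2)) Φ) := by
  rw [truncatedToeplitz]
  congr 1
  apply Lp.ext
  filter_upwards [Lp.coeFn_lpSMul (r := 2) Φ (hf.toLp (f : LpT 2)),
    coeFn_mulL (hf.toLp (f : LpT 2)) Φ] with x h1 h2
  rw [h1, h2]
  exact mul_comm _ _

theorem HasSymbol.sub {u : LpT ∞} {A : modelSpace u →L[ℂ] modelSpace u} {Φ Ψ : LpT 2}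
    (hΦ : HasSymbol u A Φ) (hΨ : HasSymbol u A Ψ) : HasSymbol u 0 (Φ - Ψ) := by
  intro f hf
  have h1 := hΦ f hf
  have h2 := hΨ f hf
  rw [truncatedToeplitz_eq] at h1 h2 ⊢
  rw [map_sub, map_sub, ← h1, ← h2, sub_self]
  rfl

/-- The backward shift `f ↦ conj z (f - f̂(0))`. -/
def backwardShift (f : LpT 2) : LpT 2 :=
  mulL (star coordZ) (f - inner ℂ (expo 0) f • expo 0)

theorem backwardShift_mem_boundedL2 {f : LpT 2} (hf : f ∈ boundedL2) :
    backwardShift f ∈ boundedL2 :=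
  mulL_mem_boundedL2 _ (sub_mem hf (Submodule.smul_mem _ _ (expo_mem_boundedL2 0)))

theorem backwardShift_mem_modelSpace {u : LpT ∞} (hu : IsInner u) {f : LpT 2}
    (hf : f ∈ modelSpace u) : backwardShift f ∈ modelSpace u := by
  rw [mem_modelSpace] at hf ⊢
  constructor
  · rw [mem_hardySpace]
    intro n hn
    rw [backwardShift, ← inner_mulL_left, mulL_coordZ_expo, inner_sub_right, inner_smul_right,
      inner_expo_expo]
    rcases eq_or_ne (n + 1) 0 with h | h
    · rw [h, if_pos rfl, mul_one, sub_self]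
    · rw [if_neg h, mul_zero, sub_zero]
      exact mem_hardySpace.1 hf.1 _ (by omega)
  · intro h hh
    rw [backwardShift, ← inner_mulL_left, inner_sub_right, inner_smul_right, mulL_comm,
      hf.2 _ (mulL_coordZ_mem_hardySpace hh), mulL_comm, ← inner_conj_symm _ (expo 0),
      inner_expo_zero_mulL_coordZ (mulL_mem_hardySpace hu hh), map_zero, mul_zero, sub_zero]

theorem mulL_toLp_backwardShift {f : LpT 2}
    (hf : MemLp f ∞ (haarAddCircle : Measure UnitAddCircle))
    (hf' : MemLp (backwardShift f) ∞ (haarAddCircle : Measure UnitAddCircle)) (Φ : LpT 2) :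
    mulL (hf'.toLp _) Φ =
      mulL (star coordZ) (mulL (hf.toLp _) Φ - inner ℂ (expo 0) f • Φ) := by
  set c : ℂ := inner ℂ (expo 0) f with hc
  apply Lp.ext
  filter_upwards [coeFn_mulL (hf'.toLp _) Φ, hf'.coeFn_toLp, hf.coeFn_toLp,
    coeFn_mulL (star coordZ) (f - c • expo 0),
    Lp.coeFn_sub f (c • expo 0), Lp.coeFn_smul c (expo 0), coeFn_expo_zero,
    coeFn_mulL (star coordZ) (mulL (hf.toLp _) Φ - c • Φ),
    Lp.coeFn_sub (mulL (hf.toLp _) Φ) (c • Φ), Lp.coeFn_smul c Φ, coeFn_mulL (hf.toLp _) Φ]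
    with x h1 h2 h3 h4 h5 h6 h7 h8 h9 h10 h11
  rw [h1, h2, h8, h9, Pi.sub_apply, h11, h3, h10, Pi.smul_apply, backwardShift, ← hc, h4, h5,
    Pi.sub_apply, h6, Pi.smul_apply, h7]
  simp only [smul_eq_mul]
  ring

theorem inner_expo_zero_mulL_toLp {f : LpT 2}
    (hf : MemLp f ∞ (haarAddCircle : Measure UnitAddCircle)) (Φ : LpT 2) :
    inner ℂ (expo 0) (mulL (hf.toLp _) Φ) = inner ℂ (star Φ) f := by
  rw [L2.inner_def, L2.inner_def]
  apply integral_congr_ae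
  filter_upwards [coeFn_expo_zero, hf.coeFn_toLp, coeFn_mulL (hf.toLp _) Φ, coeFn_star_lp Φ]
    with x h1 h2 h3 h4
  rw [h1, h3, h2, h4]
  simp

theorem inner_mulL_star_coordZ (f g : LpT 2) :
    inner ℂ (mulL (star coordZ) f) (mulL (star coordZ) g) = inner ℂ f g := by
  rw [inner_mulL_left, star_star, mulL_mulL_star norm_coordZ]

theorem HasSymbol.inner_add_inner {u : LpT ∞} (hu : IsInner u) {Φ : LpT 2}
    (hΦ : HasSymbol u 0 Φ) {f g : LpT 2} (hf : f ∈ modelSpace u) (hg : g ∈ modelSpace u)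
    (hfb : f ∈ boundedL2) :
    inner ℂ (expo 0) f * inner ℂ g Φ + inner ℂ g (expo 0) * inner ℂ (star Φ) f =
      inner ℂ (expo 0) f * inner ℂ g (expo 0) * inner ℂ (expo 0) Φ := by
  have key : ∀ f g : LpT 2, f ∈ modelSpace u → g ∈ modelSpace u →
      ∀ hfb : MemLp f ∞ (haarAddCircle : Measure UnitAddCircle),
        inner ℂ g (mulL (hfb.toLp _) Φ) = 0 := by
    intro f g hf hg hfb
    have h := hΦ ⟨f, hf⟩ hfb
    rw [truncatedToeplitz_eq, zero_apply] at h
    rw [← inner_projU u ⟨g, hg⟩, ← h, Submodule.coe_zero, inner_zero_right]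
  rw [mem_boundedL2] at hfb
  have hfb' : MemLp (backwardShift f) ∞ (haarAddCircle : Measure UnitAddCircle) :=
    backwardShift_mem_boundedL2 hfb
  have h1 := key _ _ (backwardShift_mem_modelSpace hu hf) (backwardShift_mem_modelSpace hu hg) hfb'
  rw [mulL_toLp_backwardShift hfb hfb', backwardShift, inner_mulL_star_coordZ, inner_sub_left,
    inner_sub_right, inner_sub_right, key f g hf hg hfb, inner_smul_left, inner_smul_left,
    inner_expo_zero_mulL_toLp, inner_smul_right, inner_smul_right, inner_conj_symm] at h1
  linear_combination -h1

theorem projU_mem_span_kerZero {u : LpT ∞} (hu : IsInner u) {Φ : LpT 2} (κ : ℂ)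
    (h : ∀ g : modelSpace u, (g : LpT 2) ∈ boundedL2 →
      inner ℂ (g : LpT 2) Φ = κ * inner ℂ (g : LpT 2) (expo 0)) :
    projU u Φ ∈ Submodule.span ℂ {kerZero u} := by
  rw [Submodule.mem_span_singleton]
  refine ⟨κ, ?_⟩
  rw [eq_comm, ← sub_eq_zero]
  refine eq_zero_of_forall_bounded hu fun g hg => ?_
  rw [Submodule.coe_sub, Submodule.coe_smul, inner_sub_right, inner_smul_right, inner_projU,
    inner_kerZero, h g hg, sub_self]

theorem kerZero_mem_boundedL2 {u : LpT ∞} (hu : IsInner u) :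
    (kerZero u : LpT 2) ∈ boundedL2 := by
  simpa only [Nat.cast_zero] using! projU_expo_mem_boundedL2 hu 0

theorem inner_kerZero_expo_zero_ne_zero {u : LpT ∞} (hu : IsInner u)
    (hu_nonconst : ∀ c : ℂ, u ≠ Lp.const ∞ haarAddCircle c) :
    inner ℂ (kerZero u : LpT 2) (expo 0) ≠ 0 := by
  rw [← inner_kerZero, inner_self_ne_zero]
  exact fun h => kerZero_ne_zero hu hu_nonconst (Subtype.ext h)

theorem HasSymbol.projU_mem_span {u : LpT ∞} (hu : IsInner u)
    (hu_nonconst : ∀ c : ℂ, u ≠ Lp.const ∞ haarAddCircle c) {Φ : LpT 2}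
    (hΦ : HasSymbol u 0 Φ) : projU u Φ ∈ Submodule.span ℂ {kerZero u} := by
  have he : inner ℂ (expo 0) (kerZero u : LpT 2) ≠ 0 := by
    rw [← inner_conj_symm, map_ne_zero]
    exact inner_kerZero_expo_zero_ne_zero hu hu_nonconst
  refine projU_mem_span_kerZero hu (inner ℂ (expo 0) Φ -
    inner ℂ (star Φ) (kerZero u : LpT 2) / inner ℂ (expo 0) (kerZero u : LpT 2)) fun g _ => ?_
  have h := hΦ.inner_add_inner hu (kerZero u).2 g.2 (kerZero_mem_boundedL2 hu)
  field_simp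
  linear_combination h

theorem HasSymbol.projU_star_mem_span {u : LpT ∞} (hu : IsInner u)
    (hu_nonconst : ∀ c : ℂ, u ≠ Lp.const ∞ haarAddCircle c) {Φ : LpT 2}
    (hΦ : HasSymbol u 0 Φ) : projU u (star Φ) ∈ Submodule.span ℂ {kerZero u} := by
  have he := inner_kerZero_expo_zero_ne_zero hu hu_nonconst
  refine projU_mem_span_kerZero hu (starRingEnd ℂ (inner ℂ (expo 0) Φ -
    inner ℂ (kerZero u : LpT 2) Φ / inner ℂ (kerZero u : LpT 2) (expo 0))) fun f hf => ?_
  have h := hΦ.inner_add_inner hu f.2 (kerZero u).2 hf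
  rw [← inner_conj_symm, ← inner_conj_symm (f : LpT 2) (expo 0), ← map_mul]
  congr 1
  field_simp
  linear_combination h

/-! ### The line spanned by the reproducing kernel -/

theorem inner_expo_star_eq_zero {h : LpT 2} (hh : h ∈ hardySpace) {n : ℤ} (hn : 0 < n) :
    inner ℂ (expo n) (star h) = 0 := by
  rw [← neg_neg n, ← star_expo, inner_star_star, ← inner_conj_symm,
    mem_hardySpace.1 hh _ (by omega), map_zero]

theorem projU_star_mem_span_kerZero {u : LpT ∞} (hu : IsInner u) {h : LpT 2}
    (hh : h ∈ hardySpace) : projU u (star h) ∈ Submodule.span ℂ {kerZero u} := by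
  refine projU_mem_span_kerZero hu (inner ℂ (expo 0) (star h)) fun g _ => ?_
  rw [← inner_smul_right, ← sub_eq_zero, ← inner_sub_right]
  refine inner_eq_zero_of_mem_hardySpace (mem_modelSpace.1 g.2).1 fun n hn => ?_
  rw [inner_sub_right, inner_smul_right, inner_expo_expo]
  rcases hn.eq_or_lt with rfl | hn
  · rw [if_pos rfl, mul_one, sub_self]
  · rw [inner_expo_star_eq_zero hh hn, if_neg (by omega), mul_zero, sub_zero]

theorem shiftConj_eq (u : LpT ∞) (φ : modelSpace u) :
    shiftConj u φ = projU u (mulL u (star (φ : LpT 2))) := by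
  rw [shiftConj, mulL_coordZ_conjC]

theorem shiftConj_sub (u : LpT ∞) (φ ψ : modelSpace u) :
    shiftConj u (φ - ψ) = shiftConj u φ - shiftConj u ψ := by
  simp only [shiftConj_eq, Submodule.coe_sub, star_sub_lp, map_sub]

theorem shiftConj_smul (u : LpT ∞) (c : ℂ) (φ : modelSpace u) :
    shiftConj u (c • φ) = star c • shiftConj u φ := by
  simp only [shiftConj_eq, Submodule.coe_smul, star_smul_lp, map_smul]

theorem shiftConj_mem_span {u : LpT ∞} (hu : IsInner u) {φ : modelSpace u}
    (hφ : φ ∈ Submodule.span ℂ {kerZero u}) :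
    shiftConj u φ ∈ Submodule.span ℂ {kerZero u} := by
  obtain ⟨a, rfl⟩ := Submodule.mem_span_singleton.1 hφ
  rw [shiftConj_smul]
  refine Submodule.smul_mem _ _ ?_
  obtain ⟨c, hc⟩ := exists_kerZero hu
  rw [shiftConj_eq, hc, star_sub_lp, star_smul_lp, star_mulL, star_expo_zero, map_sub, map_smul,
    mulL_mulL_star hu.norm_eq_one, map_sub, projU_mulL_eq_zero (expo_mem_hardySpace le_rfl),
    map_smul, zero_sub]
  exact neg_mem (Submodule.smul_mem _ _ (Submodule.mem_span_singleton_self _))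

theorem inner_mulL_star_left (u : LpT ∞) (f g : LpT 2) :
    inner ℂ (mulL u (star g)) f = inner ℂ (mulL u (star f)) g := by
  rw [inner_mulL_left, inner_star_left, star_mulL, star_star]

theorem mulL_star_mem_modelSpace {u : LpT ∞} (hu : IsInner u) {g : LpT 2}
    (hg : g ∈ modelSpace u) (hg0 : inner ℂ g (expo 0) = 0) :
    mulL u (star g) ∈ modelSpace u := by
  rw [mem_modelSpace] at hg ⊢
  constructor
  · rw [mem_hardySpace]
    intro n hn
    rw [← inner_conj_symm, inner_mulL_star_left, star_expo,
      hg.2 _ (expo_mem_hardySpace (by omega)), map_zero]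
  · intro h hh
    rw [inner_mulL_mulL hu.norm_eq_one]
    refine inner_eq_zero_of_mem_hardySpace hh fun n hn => ?_
    rcases hn.eq_or_lt with rfl | hn
    · rw [← star_expo_zero, inner_star_star, hg0]
    · exact inner_expo_star_eq_zero hg.1 hn

theorem mem_span_of_shiftConj_mem_span {u : LpT ∞} (hu : IsInner u)
    (hu_nonconst : ∀ c : ℂ, u ≠ Lp.const ∞ haarAddCircle c) {φ : modelSpace u}
    (hφ : shiftConj u φ ∈ Submodule.span ℂ {kerZero u}) :
    φ ∈ Submodule.span ℂ {kerZero u} := by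
  have he : inner ℂ (kerZero u : LpT 2) (kerZero u : LpT 2) ≠ 0 := by
    rw [inner_kerZero]
    exact inner_kerZero_expo_zero_ne_zero hu hu_nonconst
  obtain ⟨l, hl⟩ := Submodule.mem_span_singleton.1 hφ
  have key : ∀ g : modelSpace u, inner ℂ (g : LpT 2) (kerZero u : LpT 2) = 0 →
      inner ℂ (g : LpT 2) (φ : LpT 2) = 0 := by
    intro g hg
    rw [inner_kerZero] at hg
    have hmem := mulL_star_mem_modelSpace hu g.2 hg
    have h1 := inner_projU u ⟨_, hmem⟩ (mulL u (star (φ : LpT 2)))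
    rw [← shiftConj_eq, ← hl, Submodule.coe_smul, inner_smul_right, inner_kerZero,
      inner_mulL_star_left, star_expo_zero,
      (mem_modelSpace.1 g.2).2 _ (expo_mem_hardySpace le_rfl), mul_zero,
      inner_mulL_mulL hu.norm_eq_one, inner_star_star] at h1
    rw [← inner_conj_symm, ← h1, map_zero]
  set t : ℂ := inner ℂ (kerZero u : LpT 2) (φ : LpT 2) /
    inner ℂ (kerZero u : LpT 2) (kerZero u : LpT 2) with ht
  refine Submodule.mem_span_singleton.2 ⟨t, ?_⟩
  have h0 : inner ℂ ((φ - t • kerZero u : modelSpace u) : LpT 2) (kerZero u : LpT 2) = 0 := by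
    rw [← inner_conj_symm, Submodule.coe_sub, Submodule.coe_smul, inner_sub_right,
      inner_smul_right, ht, div_mul_cancel₀ _ he, sub_self, map_zero]
  have h1 : inner ℂ ((φ - t • kerZero u : modelSpace u) : LpT 2)
      ((φ - t • kerZero u : modelSpace u) : LpT 2) = 0 := by
    conv_lhs => arg 3; rw [Submodule.coe_sub, Submodule.coe_smul]
    rw [inner_sub_right, inner_smul_right, h0, key _ h0, mul_zero, sub_zero]
  exact (sub_eq_zero.1 (Subtype.ext (inner_self_eq_zero.1 h1))).symm

/-! ### Types -/

theorem mulL_toLp_expo_zero {f : LpT 2}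
    (hf : MemLp f ∞ (haarAddCircle : Measure UnitAddCircle)) :
    mulL (hf.toLp _) (expo 0) = f := by
  apply Lp.ext
  filter_upwards [coeFn_mulL (hf.toLp _) (expo 0), hf.coeFn_toLp, coeFn_expo_zero] with x h1 h2 h3
  rw [h1, h2, h3, mul_one]

theorem hasSymbol_kerZero {u : LpT ∞} (hu : IsInner u) :
    HasSymbol u (ContinuousLinearMap.id ℂ _) (kerZero u) := by
  intro f hf
  obtain ⟨c, hc⟩ := exists_kerZero hu
  rw [truncatedToeplitz_eq, hc, map_sub, map_smul, mulL_comm, mulL_toLp_expo_zero, map_sub,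
    map_smul, projU_mulL_eq_zero (mem_modelSpace.1 f.2).1, smul_zero, sub_zero, projU_coe]
  rfl

theorem hasSymbol_star_kerZero {u : LpT ∞} (hu : IsInner u) :
    HasSymbol u (ContinuousLinearMap.id ℂ _) (star (kerZero u : LpT 2)) := by
  intro f hf
  obtain ⟨c, hc⟩ := exists_kerZero hu
  rw [truncatedToeplitz_eq, hc, star_sub_lp, star_smul_lp, star_mulL, star_expo_zero, map_sub,
    map_smul, mulL_comm, mulL_toLp_expo_zero, map_sub, map_smul, projU_mulL_star_eq_zero f.2,
    smul_zero, sub_zero, projU_coe]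
  rfl

theorem hasSymbol_expo_zero (u : LpT ∞) :
    HasSymbol u (ContinuousLinearMap.id ℂ _) (expo 0) := by
  intro f hf
  rw [truncatedToeplitz_eq, mulL_toLp_expo_zero, projU_coe]
  rfl

theorem HasSymbol.add {u : LpT ∞} {A B : modelSpace u →L[ℂ] modelSpace u} {Φ Ψ : LpT 2}
    (hΦ : HasSymbol u A Φ) (hΨ : HasSymbol u B Ψ) : HasSymbol u (A + B) (Φ + Ψ) := by
  intro f hf
  have h1 := hΦ f hf
  have h2 := hΨ f hf
  rw [truncatedToeplitz_eq] at h1 h2 ⊢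
  rw [map_add, map_add, ← h1, ← h2]
  rfl

theorem HasSymbol.smul {u : LpT ∞} {A : modelSpace u →L[ℂ] modelSpace u} {Φ : LpT 2}
    (hΦ : HasSymbol u A Φ) (c : ℂ) : HasSymbol u (c • A) (c • Φ) := by
  intro f hf
  have h1 := hΦ f hf
  rw [truncatedToeplitz_eq] at h1 ⊢
  rw [map_smul, map_smul, ← h1]
  rfl

theorem HasSymbol.unique {u : LpT ∞} (hu : IsInner u) {A B : modelSpace u →L[ℂ] modelSpace u}
    {Φ : LpT 2} (hA : HasSymbol u A Φ) (hB : HasSymbol u B Φ) : A = B := by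
  have hd : Dense (boundedL2.comap (modelSpace u).subtype : Set (modelSpace u)) := by
    rw [Submodule.dense_iff_topologicalClosure_eq_top,
      Submodule.topologicalClosure_eq_top_iff, Submodule.eq_bot_iff]
    intro g hg
    exact eq_zero_of_forall_bounded hu fun f hf => (Submodule.mem_orthogonal _ g).1 hg f hf
  ext1 f
  exact congrFun (Continuous.ext_on hd A.continuous B.continuous
    fun g hg => (hA g hg).trans (hB g hg).symm) f

theorem eq_smul_id_of_mem_span {u : LpT ∞} (hu : IsInner u)
    {A : modelSpace u →L[ℂ] modelSpace u} {φ : modelSpace u} {α c : ℂ}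
    (hA : HasSymbol u A
      ((φ : LpT 2) + α • star (shiftConj u φ : LpT 2) + Lp.const 2 haarAddCircle c))
    (hφ : φ ∈ Submodule.span ℂ {kerZero u}) :
    ∃ c : ℂ, A = c • ContinuousLinearMap.id ℂ (modelSpace u) := by
  obtain ⟨b, hb⟩ := Submodule.mem_span_singleton.1 (shiftConj_mem_span hu hφ)
  obtain ⟨a, ha⟩ := Submodule.mem_span_singleton.1 hφ
  rw [← hb, ← ha, const_eq_smul_expo, Submodule.coe_smul, Submodule.coe_smul, star_smul_lp] at hA
  refine ⟨a + α * star b + c, hA.unique hu ?_⟩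
  convert! (((hasSymbol_kerZero hu).smul a).add
    (((hasSymbol_star_kerZero hu).smul (star b)).smul α)).add ((hasSymbol_expo_zero u).smul c)
    using 1
  ext1 f
  simp [add_smul, mul_smul]

theorem projU_symbol_sub_mem_span {u : LpT ∞} (hu : IsInner u) (φ : modelSpace u) (α c : ℂ) :
    projU u ((φ : LpT 2) + α • star (shiftConj u φ : LpT 2) + Lp.const 2 haarAddCircle c) - φ ∈
      Submodule.span ℂ {kerZero u} := by
  rw [const_eq_smul_expo, map_add, map_add, map_smul, map_smul, projU_coe, add_assoc,
    add_sub_cancel_left]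
  exact add_mem (Submodule.smul_mem _ _
    (projU_star_mem_span_kerZero hu (mem_modelSpace.1 (shiftConj u φ).2).1))
    (Submodule.smul_mem _ _ (Submodule.mem_span_singleton_self _))

theorem projU_star_symbol_sub_mem_span {u : LpT ∞} (hu : IsInner u) (φ : modelSpace u)
    (α c : ℂ) :
    projU u (star ((φ : LpT 2) + α • star (shiftConj u φ : LpT 2) +
      Lp.const 2 haarAddCircle c)) - star α • shiftConj u φ ∈ Submodule.span ℂ {kerZero u} := by
  rw [const_eq_smul_expo, star_add_lp, star_add_lp, star_smul_lp, star_smul_lp, star_star,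
    star_expo_zero, map_add, map_add, map_smul, map_smul, projU_coe, add_right_comm,
    add_sub_cancel_right]
  exact add_mem (projU_star_mem_span_kerZero hu (mem_modelSpace.1 φ.2).1)
    (Submodule.smul_mem _ _ (Submodule.mem_span_singleton_self _))

theorem eq_smul_id_of_isOfType_coe_of_isOfType_infty {u : LpT ∞} (hu : IsInner u)
    (hu_nonconst : ∀ c : ℂ, u ≠ Lp.const ∞ haarAddCircle c)
    {A : modelSpace u →L[ℂ] modelSpace u} {α : ℂ} (hα : IsOfType u A (α : OnePoint ℂ))
    (hinf : IsOfType u A OnePoint.infty) :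
    ∃ c : ℂ, A = c • ContinuousLinearMap.id ℂ (modelSpace u) := by
  obtain ⟨φ, c, hφ⟩ := hα
  obtain ⟨ψ, hψ, hA⟩ := hinf
  refine eq_smul_id_of_mem_span hu hφ ?_
  have h1 := (hφ.sub hA).projU_mem_span hu hu_nonconst
  rw [map_sub] at h1
  have h2 := sub_mem (add_mem h1 (projU_star_mem_span_kerZero hu hψ))
    (projU_symbol_sub_mem_span hu φ α c)
  rwa [sub_add_cancel, sub_sub_cancel] at h2

theorem eq_smul_id_of_isOfType_coe_of_ne {u : LpT ∞} (hu : IsInner u)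
    (hu_nonconst : ∀ c : ℂ, u ≠ Lp.const ∞ haarAddCircle c)
    {A : modelSpace u →L[ℂ] modelSpace u} {α β : ℂ} (hαβ : α ≠ β)
    (hα : IsOfType u A (α : OnePoint ℂ)) (hβ : IsOfType u A (β : OnePoint ℂ)) :
    ∃ c : ℂ, A = c • ContinuousLinearMap.id ℂ (modelSpace u) := by
  obtain ⟨φ, c, hφ⟩ := hα
  obtain ⟨ψ, d, hψ⟩ := hβ
  refine eq_smul_id_of_mem_span hu hφ (mem_span_of_shiftConj_mem_span hu hu_nonconst ?_)
  have h1 := (hφ.sub hψ).projU_mem_span hu hu_nonconst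
  have h2 := (hφ.sub hψ).projU_star_mem_span hu hu_nonconst
  rw [map_sub] at h1
  rw [star_sub_lp, map_sub] at h2
  have h3 := sub_mem (add_mem h1 (projU_symbol_sub_mem_span hu ψ β d))
    (projU_symbol_sub_mem_span hu φ α c)
  have h4 := sub_mem (add_mem h2 (projU_star_symbol_sub_mem_span hu ψ β d))
    (projU_star_symbol_sub_mem_span hu φ α c)
  rw [sub_add_sub_cancel, sub_sub_sub_cancel_left] at h3 h4
  have h5 := sub_mem h4 (Submodule.smul_mem _ (star β) (shiftConj_mem_span hu h3))
  rw [shiftConj_sub] at h5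
  have h6 : star α • shiftConj u φ - star β • shiftConj u ψ -
      star β • (shiftConj u φ - shiftConj u ψ) = (star α - star β) • shiftConj u φ := by
    module
  rw [h6] at h5
  exact (Submodule.smul_mem_iff _ (sub_ne_zero.2 (star_injective.ne hαβ))).1 h5

theorem isOfType_smul_id (u : LpT ∞) (c : ℂ) (α : OnePoint ℂ) :
    IsOfType u (c • ContinuousLinearMap.id ℂ (modelSpace u)) α := by
  induction α using OnePoint.rec with
  | infty =>
    refine ⟨star c • expo 0, Submodule.smul_mem _ _ (expo_mem_hardySpace le_rfl), ?_⟩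
    rw [star_smul_lp, star_star, star_expo_zero]
    exact (hasSymbol_expo_zero u).smul c
  | coe α =>
    refine ⟨0, c, ?_⟩
    have h : shiftConj u 0 = 0 := by simpa using shiftConj_sub u 0 0
    have h0 : star (0 : LpT 2) = 0 := by simpa using star_sub_lp 0 0
    rw [h, Submodule.coe_zero, h0, smul_zero, zero_add, zero_add, const_eq_smul_expo]
    exact (hasSymbol_expo_zero u).smul c

theorem eq_smul_id_of_isOfType_of_ne {u : LpT ∞} (hu : IsInner u)
    (hu_nonconst : ∀ c : ℂ, u ≠ Lp.const ∞ haarAddCircle c)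
    {A : modelSpace u →L[ℂ] modelSpace u} {α β : OnePoint ℂ} (hαβ : α ≠ β)
    (hα : IsOfType u A α) (hβ : IsOfType u A β) :
    ∃ c : ℂ, A = c • ContinuousLinearMap.id ℂ (modelSpace u) := by
  induction α using OnePoint.rec with
  | infty =>
    induction β using OnePoint.rec with
    | infty => exact absurd rfl hαβ
    | coe β => exact eq_smul_id_of_isOfType_coe_of_isOfType_infty hu hu_nonconst hβ hα
  | coe α =>
    induction β using OnePoint.rec with
    | infty => exact eq_smul_id_of_isOfType_coe_of_isOfType_infty hu hu_nonconst hα hβ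
    | coe β =>
      exact eq_smul_id_of_isOfType_coe_of_ne hu hu_nonconst (fun h => hαβ (by rw [h])) hα hβ

end TTO

end

theorem mainTheorem10 (u : TTO.LpT ∞) (hu : TTO.IsInner u)
    (hu_nonconst : ∀ c : ℂ, u ≠ Lp.const ∞ haarAddCircle c)
    (A : TTO.modelSpace u →L[ℂ] TTO.modelSpace u) (hA : A ∈ TTO.boundedTTO u) :
    (∀ α β : OnePoint ℂ, α ≠ β → TTO.IsOfType u A α → TTO.IsOfType u A β →
      ∃ c : ℂ, A = c • ContinuousLinearMap.id ℂ (TTO.modelSpace u)) ∧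
    ((∀ α : OnePoint ℂ, ¬ TTO.IsOfType u A α) ∨ (∃! α : OnePoint ℂ, TTO.IsOfType u A α) ∨
      (∀ α : OnePoint ℂ, TTO.IsOfType u A α)) := by
  refine ⟨fun α β h => TTO.eq_smul_id_of_isOfType_of_ne hu hu_nonconst h, ?_⟩
  by_cases hne : ∃ α, TTO.IsOfType u A α
  · obtain ⟨α, hα⟩ := hne
    by_cases huniq : ∀ β, TTO.IsOfType u A β → β = α
    · exact Or.inr (Or.inl ⟨α, hα, huniq⟩)
    · push Not at huniq
      obtain ⟨β, hβ, hβα⟩ := huniq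
      obtain ⟨c, rfl⟩ := TTO.eq_smul_id_of_isOfType_of_ne hu hu_nonconst hβα hβ hα
      exact Or.inr (Or.inr (TTO.isOfType_smul_id u c))
  · exact Or.inl (not_exists.1 hne)
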